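/- Let $|\psi\rangle\in\mathbb{C}^{d_1}\otimes\mathbb{C}^{d_2}\otimes\mathbb{C}^{d_3}\otimes\mathbb{C}^{d_4}$ be a four-partite pure state (a unit vector) in arbitrary local dimensions. For a set $S$ of parties, with complement $\bar S$, let $C_{S|\bar S}(|\psi\rangle)=\sqrt{2\,[1-\mathrm{Tr}(\rho_S^2)]}$ be the concurrence across the bipartition $S|\bar S$, where $\rho_S=\mathrm{Tr}_{\bar S}|\psi\rangle\langle\psi|$. Put $$a=\sqrt[4]{C_{1|234}\,C_{2|134}\,C_{3|124}\,C_{4|123}},\qquad h=\sqrt[3]{C_{12|34}\,C_{13|24}\,C_{14|23}},\qquad V_{1234}(|\psi\rangle)=\tfrac13 a^2h,$$ the volume of the "concurrence rectangular pyramid", whose base is a square of side $a$ and whose height is $h$. Call a density operator biseparable if it is a convex combination of pure states each of which is a product across some bipartition of the four parties into two nonempty groups, and genuinely multipartite entangled (GME) otherwise. Then $V_{1234}$ is a GME measure for four-partite pure states, that is: (i) $V_{1234}(|\psi\rangle)=0$ if $|\psi\rangle\langle\psi|$ is biseparable; equivalently, $V_{1234}(|\psi\rangle)=0$ if and only if $|\psi\rangle$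 is a product across some bipartition; (ii) $V_{1234}(|\psi\rangle)>0$ if and only if $|\psi\rangle$ is GME; (iii) $V_{1234}$ is non-increasing under LOCC: if a four-party LOCC map $\Lambda$ (a protocol with finitely many rounds and finitely many measurement outcomes, in which local dimensions may change) satisfies $\Lambda(|\psi\rangle\langle\psi|)=|\varphi\rangle\langle\varphi|$ for pure states $|\psi\rangle$, $|\varphi\rangle$, then $V_{1234}(|\varphi\rangle)\le V_{1234}(|\psi\rangle)$. Moreover, as a function of the seven nonnegative numbers $C_{i|jkl}$, $C_{ij|kl}$, the volume $\tfrac13a^2h$ is non-decreasing in each of them. -/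

import Mathlib

open scoped Matrix

namespace FourPartite

/-- The product basis of `ℂ^(d 0) ⊗ ℂ^(d 1) ⊗ ℂ^(d 2) ⊗ ℂ^(d 3)`. The four parties are
indexed by `Fin 4`, that is, party `n` of the literature is `n - 1` here. -/
abbrev Idx (d : Fin 4 → ℕ) : Type := (i : Fin 4) → Fin (d i)

/-- The four-partite Hilbert space with local dimensions `d`, in coordinates with respect to
the product basis. Pure states are its unit vectors. -/
abbrev Hilb (d : Fin 4 → ℕ) : Type := EuclideanSpace ℂ (Idx d)

/-- Operators on the four-partite Hilbert space. -/
abbrev Op (d : Fin 4 → ℕ) : Type := Matrix (Idx d) (Idx d) ℂ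

/-- Basis labels of the parties in `S`. -/
abbrev SubIdx (d : Fin 4 → ℕ) (S : Finset (Fin 4)) : Type :=
  (i : {i : Fin 4 // i ∈ S}) → Fin (d i)

/-- Basis labels of the parties outside `S`. -/
abbrev CoIdx (d : Fin 4 → ℕ) (S : Finset (Fin 4)) : Type :=
  (i : {i : Fin 4 // ¬ i ∈ S}) → Fin (d i)

/-- Combine labels for the parties in `S` and for those outside `S` to a joint label. -/
def glue {d : Fin 4 → ℕ} (S : Finset (Fin 4)) (x : SubIdx d S) (y : CoIdx d S) : Idx d :=
  (Equiv.piEquivPiSubtypeProd (fun i : Fin 4 => i ∈ S) (fun i => Fin (d i))).symm (x, y)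

/-- The rank one operator `|ψ⟩⟨ψ|`. -/
def density {d : Fin 4 → ℕ} (ψ : Hilb d) : Op d :=
  Matrix.of fun x y => ψ x * star (ψ y)

/-- The partial trace over the parties outside `S`. -/
def partialTrace {d : Fin 4 → ℕ} (S : Finset (Fin 4)) (ρ : Op d) :
    Matrix (SubIdx d S) (SubIdx d S) ℂ :=
  Matrix.of fun x x' => ∑ y : CoIdx d S, ρ (glue S x y) (glue S x' y)

/-- The concurrence `√(2 (1 - Tr ρ_S²))` of `ψ` across the bipartition `S | Sᶜ`. -/
noncomputable def concurrence {d : Fin 4 → ℕ} (S : Finset (Fin 4)) (ψ : Hilb d) : ℝ :=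
  Real.sqrt (2 * (1 - (Matrix.trace (partialTrace S (density ψ) ^ 2)).re))

/-- The geometric mean of four numbers: the length of the bottom edges of the pyramid. -/
noncomputable def edgeLength (c : Fin 4 → ℝ) : ℝ := (∏ i, c i) ^ ((1 : ℝ) / 4)

/-- The geometric mean of three numbers: the height of the pyramid. -/
noncomputable def height (e : Fin 3 → ℝ) : ℝ := (∏ j, e j) ^ ((1 : ℝ) / 3)

/-- The volume of the pyramid of height `h` over a square of side `a`, as a function of the
four 1|3 concurrences `c` and the three 2|2 concurrences `e`. -/
noncomputable def pyramidVolume (c : Fin 4 → ℝ) (e : Fin 3 → ℝ) : ℝ :=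
  1 / 3 * edgeLength c ^ 2 * height e

/-- The concurrences `C_{1|234}, C_{2|134}, C_{3|124}, C_{4|123}`. -/
noncomputable def oneThree {d : Fin 4 → ℕ} (ψ : Hilb d) : Fin 4 → ℝ :=
  fun i => concurrence {i} ψ

/-- The concurrences `C_{12|34}, C_{13|24}, C_{14|23}`. -/
noncomputable def twoTwo {d : Fin 4 → ℕ} (ψ : Hilb d) : Fin 3 → ℝ :=
  fun j => concurrence {0, j.succ} ψ

/-- The volume `V_{1234}` of the concurrence rectangular pyramid of `ψ`. -/
noncomputable def V {d : Fin 4 → ℕ} (ψ : Hilb d) : ℝ :=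
  pyramidVolume (oneThree ψ) (twoTwo ψ)

/-- `ψ = α ⊗ β` for a vector `α` of the parties in `S` and a vector `β` of the others. -/
def IsProductAcross {d : Fin 4 → ℕ} (S : Finset (Fin 4)) (ψ : Hilb d) : Prop :=
  ∃ (α : SubIdx d S → ℂ) (β : CoIdx d S → ℂ), ∀ x y, ψ (glue S x y) = α x * β y

/-- `ψ` is a product across some bipartition into two nonempty groups of parties. -/
def IsBiproduct {d : Fin 4 → ℕ} (ψ : Hilb d) : Prop :=
  ∃ S : Finset (Fin 4), S.Nonempty ∧ Sᶜ.Nonempty ∧ IsProductAcross S ψ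

/-- Biseparable density operators: convex combinations of pure states each of which is a
product across some bipartition (which may vary with the term). -/
def IsBiseparable {d : Fin 4 → ℕ} (ρ : Op d) : Prop :=
  ρ ∈ convexHull ℝ {σ : Op d | ∃ φ : Hilb d, ‖φ‖ = 1 ∧ IsBiproduct φ ∧ σ = density φ}

/-- Genuine multipartite entanglement: not biseparable. -/
def IsGME {d : Fin 4 → ℕ} (ρ : Op d) : Prop := ¬ IsBiseparable ρ

/-- The product operator `A 0 ⊗ A 1 ⊗ A 2 ⊗ A 3`. -/
def tensorOp {d e : Fin 4 → ℕ} (A : (j : Fin 4) → Matrix (Fin (e j)) (Fin (d j)) ℂ) :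
    Matrix (Idx e) (Idx d) ℂ :=
  Matrix.of fun x y => ∏ j, A j (x j) (y j)

/-- `IsLOCC d' d Λ`: the map `Λ`, from operators with local dimensions `d` to operators with
local dimensions `d'`, is carried out by a protocol of local operations and classical
communication with finitely many rounds. Either nothing is done, or in the first round some
party `i` performs a measurement with finitely many outcomes `k` and Kraus operators `A k i`,
tells `k` to all the others, each other party `j` applies an isometry `A k j` (for example the
identity, or the adjunction of an ancilla), and the protocol continues in a way that may depend
on `k`; the outcomes are summed over at the end. Local dimensions may change in each round.
A local channel of a party is a measurement whose outcome is ignored later on, and shared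
randomness is a measurement with Kraus operators proportional to the identity. -/
inductive IsLOCC (d' : Fin 4 → ℕ) : (d : Fin 4 → ℕ) → (Op d → Op d') → Prop
  | done : IsLOCC d' d' (fun ρ => ρ)
  | round (d : Fin 4 → ℕ) (i : Fin 4) (m : ℕ) (e : Fin m → Fin 4 → ℕ)
      (A : (k : Fin m) → (j : Fin 4) → Matrix (Fin (e k j)) (Fin (d j)) ℂ)
      (measurement : ∑ k, (A k i)ᴴ * A k i = 1)
      (isometry : ∀ k j, j ≠ i → (A k j)ᴴ * A k j = 1)
      (Λ : (k : Fin m) → Op (e k) → Op d')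
      (rest : ∀ k, IsLOCC d' (e k) (Λ k)) :
      IsLOCC d' d (fun ρ => ∑ k, Λ k (tensorOp (A k) * ρ * (tensorOp (A k))ᴴ))

/-- A measure of genuine multipartite entanglement of four-partite pure states, in all local
dimensions: it vanishes on biseparable states, is positive on all other states, and does not
increase when an LOCC map transforms a pure state into a pure state. -/
structure IsGMEMeasure (E : (d : Fin 4 → ℕ) → Hilb d → ℝ) : Prop where
  zero : ∀ (d : Fin 4 → ℕ) (ψ : Hilb d), ‖ψ‖ = 1 → IsBiseparable (density ψ) → E d ψ = 0
  pos : ∀ (d : Fin 4 → ℕ) (ψ : Hilb d), ‖ψ‖ = 1 → ¬ IsBiseparable (density ψ) → 0 < E d ψ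
  locc : ∀ (d d' : Fin 4 → ℕ) (ψ : Hilb d) (φ : Hilb d') (Λ : Op d → Op d'),
    ‖ψ‖ = 1 → ‖φ‖ = 1 → IsLOCC d' d Λ → Λ (density ψ) = density φ → E d' φ ≤ E d ψ

end FourPartite

open FourPartite

namespace FourPartite

/-! ### Concurrence of a bipartite coefficient matrix -/

section Bipartite

variable {X Y X' : Type*} [Fintype X] [Fintype Y] [Fintype X']

/-! Everything reduces to one bipartition at a time. The squared concurrence is the sum of `‖·‖ ^ 2`
over all 2×2 minors of the coefficient matrix (`sum_norm_sq_minors`), so it vanishes exactly on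
product vectors. Up to complement the bipartitions are the seven entering the volume, hence `V ψ =
0` iff `ψ` is a biproduct. Pure states are extreme (`exists_smul_of_sum_density_eq`), so for pure
states biseparable means biproduct.

For LOCC, the concurrence is a superadditive function of the reduced operator
(`sum_matrixConcurrence_le`). A measurement on one side splits the reduced operator of the other
side into a sum, so the total concurrence cannot grow, round after round. If the output is pure,
every branch is a multiple of it, and the average bound becomes a bound for each concurrence; the
volume is monotone in all of them. -/

/-- The concurrence of a bipartite vector with coefficient matrix `M`, extended homogeneously
to vectors that are not normalised. -/
noncomputable def matrixConcurrence (M : Matrix X Y ℂ) : ℝ :=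
  Real.sqrt (2 * ((M * Mᴴ).trace.re ^ 2 - (M * Mᴴ * (M * Mᴴ)).trace.re))

theorem trace_mul_conjTranspose_re (M : Matrix X Y ℂ) :
    (M * Mᴴ).trace.re = ∑ x, ∑ y, ‖M x y‖ ^ 2 := by
  simp [Matrix.trace, Matrix.mul_apply, Complex.mul_conj, Complex.normSq_eq_norm_sq]
  norm_cast

theorem trace_sq_mul_conjTranspose_re (M : Matrix X Y ℂ) :
    (M * Mᴴ * (M * Mᴴ)).trace.re = ∑ x, ∑ x', ‖(M * Mᴴ) x x'‖ ^ 2 := by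
  rw [← trace_mul_conjTranspose_re]
  simp

/-- Expanding `‖a - b‖ ^ 2`, both square terms sum to the squared trace and the cross term sums to
the purity. -/
theorem sum_norm_sq_minors (M : Matrix X Y ℂ) :
    ∑ x, ∑ x', ∑ y, ∑ y', ‖M x y * M x' y' - M x y' * M x' y‖ ^ 2 =
      2 * ((M * Mᴴ).trace.re ^ 2 - (M * Mᴴ * (M * Mᴴ)).trace.re) := by
  have h1 : ∑ x, ∑ x', ∑ y, ∑ y', ‖M x y * M x' y'‖ ^ 2 = (M * Mᴴ).trace.re ^ 2 := by
    rw [trace_mul_conjTranspose_re, pow_two, Finset.sum_mul_sum]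
    simp only [Finset.sum_mul_sum, norm_mul, mul_pow]
  have h2 : ∑ x, ∑ x', ∑ y, ∑ y', ‖M x y' * M x' y‖ ^ 2 = (M * Mᴴ).trace.re ^ 2 := by
    rw [← h1]
    refine Finset.sum_congr rfl fun x _ => Finset.sum_congr rfl fun x' _ => ?_
    exact Finset.sum_comm
  have h3 : ∑ x, ∑ x', ∑ y, ∑ y',
      (M x y * M x' y' * (starRingEnd ℂ) (M x y' * M x' y)).re = (M * Mᴴ * (M * Mᴴ)).trace.re := by
    simp only [Matrix.trace, Matrix.diag, Matrix.mul_apply, Finset.sum_mul_sum,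
      Complex.re_sum, Matrix.conjTranspose_apply, map_mul]
    refine Finset.sum_congr rfl fun x _ => Finset.sum_congr rfl fun x' _ =>
      Finset.sum_congr rfl fun y _ => Finset.sum_congr rfl fun y' _ => ?_
    congr 1
    simp only [RCLike.star_def]
    ring
  simp only [← Complex.normSq_eq_norm_sq] at h1 h2 ⊢
  simp only [Complex.normSq_sub, Finset.sum_sub_distrib, Finset.sum_add_distrib,
    ← Finset.mul_sum, h1, h2, h3]
  ring

theorem two_mul_trace_sub_nonneg (M : Matrix X Y ℂ) :
    0 ≤ 2 * ((M * Mᴴ).trace.re ^ 2 - (M * Mᴴ * (M * Mᴴ)).trace.re) := by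
  rw [← sum_norm_sq_minors]
  positivity

theorem matrixConcurrence_eq_zero_iff (M : Matrix X Y ℂ) :
    matrixConcurrence M = 0 ↔ ∀ x x' y y', M x y * M x' y' = M x y' * M x' y := by
  rw [matrixConcurrence, Real.sqrt_eq_zero (two_mul_trace_sub_nonneg M), ← sum_norm_sq_minors]
  constructor
  · intro h x x' y y'
    rw [Finset.sum_eq_zero_iff_of_nonneg fun _ _ => by positivity] at h
    have h := h x (Finset.mem_univ _)
    rw [Finset.sum_eq_zero_iff_of_nonneg fun _ _ => by positivity] at h
    have h := h x' (Finset.mem_univ _)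
    rw [Finset.sum_eq_zero_iff_of_nonneg fun _ _ => by positivity] at h
    have h := h y (Finset.mem_univ _)
    rw [Finset.sum_eq_zero_iff_of_nonneg fun _ _ => by positivity] at h
    have h := h y' (Finset.mem_univ _)
    simpa [sub_eq_zero] using h
  · intro h
    simp [sub_eq_zero.2 (h _ _ _ _)]

theorem matrixConcurrence_transpose (M : Matrix X Y ℂ) :
    matrixConcurrence Mᵀ = matrixConcurrence M := by
  rw [matrixConcurrence, matrixConcurrence, ← sum_norm_sq_minors, ← sum_norm_sq_minors]
  congr 1
  simp only [Matrix.transpose_apply]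
  calc _ = ∑ p : Y × Y, ∑ q : X × X,
        ‖M q.1 p.1 * M q.2 p.2 - M q.2 p.1 * M q.1 p.2‖ ^ 2 := by
          simp only [Fintype.sum_prod_type]
    _ = _ := by
      rw [Finset.sum_comm]
      simp only [Fintype.sum_prod_type]
      simp only [mul_comm]

theorem matrixConcurrence_smul (c : ℂ) (M : Matrix X Y ℂ) :
    matrixConcurrence (c • M) = ‖c‖ ^ 2 * matrixConcurrence M := by
  rw [matrixConcurrence, matrixConcurrence, ← sum_norm_sq_minors, ← sum_norm_sq_minors]
  rw [← Real.sqrt_sq (by positivity : 0 ≤ ‖c‖ ^ 2), ← Real.sqrt_mul (by positivity)]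
  congr 1
  simp only [Finset.mul_sum]
  refine Finset.sum_congr rfl fun x _ => Finset.sum_congr rfl fun x' _ =>
      Finset.sum_congr rfl fun y _ => Finset.sum_congr rfl fun y' _ => ?_
  rw [← norm_pow, ← norm_pow, ← norm_pow, ← norm_pow, ← norm_mul]
  congr 1
  simp only [Matrix.smul_apply, smul_eq_mul]
  ring

theorem matrixConcurrence_isometry_mul [DecidableEq X] (U : Matrix X' X ℂ) (hU : Uᴴ * U = 1)
    (M : Matrix X Y ℂ) : matrixConcurrence (U * M) = matrixConcurrence M := by
  have h1 : (U * M * (U * M)ᴴ).trace = (M * Mᴴ).trace := by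
    rw [Matrix.conjTranspose_mul, Matrix.mul_assoc, Matrix.trace_mul_comm]
    simp only [Matrix.mul_assoc, hU, Matrix.mul_one]
  have h2 : (U * M * (U * M)ᴴ * (U * M * (U * M)ᴴ)).trace = (M * Mᴴ * (M * Mᴴ)).trace := by
    have : U * M * (U * M)ᴴ * (U * M * (U * M)ᴴ) = U * (M * Mᴴ * (M * Mᴴ)) * Uᴴ := by
      rw [Matrix.conjTranspose_mul]
      calc _ = U * M * Mᴴ * (Uᴴ * U) * M * Mᴴ * Uᴴ := by simp only [Matrix.mul_assoc]
        _ = _ := by rw [hU]; simp only [Matrix.mul_assoc, Matrix.one_mul]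
    rw [this, Matrix.mul_assoc, Matrix.trace_mul_comm, Matrix.mul_assoc, hU, Matrix.mul_one]
  rw [matrixConcurrence, matrixConcurrence, h1, h2]

/-- The concurrence is a superadditive function of the reduced operator. -/
theorem sum_matrixConcurrence_le {κ : Type*} [Fintype κ] {Z : κ → Type*} [∀ k, Fintype (Z k)]
    (M : Matrix X Y ℂ) (N : (k : κ) → Matrix X (Z k) ℂ)
    (h : ∑ k, N k * (N k)ᴴ = M * Mᴴ) :
    ∑ k, matrixConcurrence (N k) ≤ matrixConcurrence M := by
  -- Adjoining the concurrence to `√2 ρ_k`, where `ρ_k = N k * (N k)ᴴ`, gives a vector of norm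
  -- exactly `√2 Tr ρ_k`. These norms add up to `√2 Tr ρ`, so the triangle inequality yields the
  -- claim.
  let v : κ → EuclideanSpace ℂ (Unit ⊕ X × X) := fun k =>
    WithLp.toLp 2 (Sum.elim (fun _ => (matrixConcurrence (N k) : ℂ))
      fun p => (Real.sqrt 2 : ℂ) * (N k * (N k)ᴴ) p.1 p.2)
  have hs : (Real.sqrt 2) ^ 2 = 2 := Real.sq_sqrt (by norm_num)
  have hv : ∀ k, ‖v k‖ = Real.sqrt 2 * (N k * (N k)ᴴ).trace.re := by
    intro k
    have h0 : 0 ≤ Real.sqrt 2 * (N k * (N k)ᴴ).trace.re := by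
      rw [trace_mul_conjTranspose_re]; positivity
    rw [← sq_eq_sq₀ (norm_nonneg _) h0, EuclideanSpace.norm_sq_eq]
    simp only [v, Fintype.sum_sum_type, Sum.elim_inl, Sum.elim_inr, norm_mul, mul_pow,
      Complex.norm_real, Real.norm_eq_abs, sq_abs, hs, ← Finset.mul_sum,
      Fintype.sum_prod_type, Fintype.sum_unique]
    rw [← trace_sq_mul_conjTranspose_re, matrixConcurrence,
      Real.sq_sqrt (two_mul_trace_sub_nonneg _)]
    ring
  have hsum : ∑ k, ‖v k‖ = Real.sqrt 2 * (M * Mᴴ).trace.re := by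
    simp only [hv, ← Finset.mul_sum, ← h, Matrix.trace_sum, Complex.re_sum]
  have key : ‖∑ k, v k‖ ^ 2 = (∑ k, matrixConcurrence (N k)) ^ 2 +
      2 * (M * Mᴴ * (M * Mᴴ)).trace.re := by
    have e1 : (∑ k, v k) (Sum.inl ()) = ((∑ k, matrixConcurrence (N k) : ℝ) : ℂ) := by
      simp [v]
    have e2 : ∀ p : X × X, (∑ k, v k) (Sum.inr p) = (Real.sqrt 2 : ℂ) * (M * Mᴴ) p.1 p.2 := by
      intro p
      simp [v, ← h, Matrix.sum_apply, Finset.mul_sum]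
    rw [EuclideanSpace.norm_sq_eq, Fintype.sum_sum_type, Fintype.sum_unique]
    simp only [PUnit.default_eq_unit, e1, e2, norm_mul, mul_pow,
      Complex.norm_real, Real.norm_eq_abs, sq_abs, hs, ← Finset.mul_sum, Fintype.sum_prod_type]
    rw [← trace_sq_mul_conjTranspose_re]
  have tri : ‖∑ k, v k‖ ^ 2 ≤ (Real.sqrt 2 * (M * Mᴴ).trace.re) ^ 2 := by
    rw [← hsum]
    exact pow_le_pow_left₀ (norm_nonneg _) (norm_sum_le _ _) 2
  refine Real.le_sqrt_of_sq_le ?_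
  rw [key, mul_pow, hs] at tri
  linarith

/-- On average, the concurrence does not increase when one side is measured while isometries
are applied to the other side. -/
theorem sum_matrixConcurrence_isometry_measurement_le [DecidableEq X] [DecidableEq Y]
    {κ : Type*} [Fintype κ] {X' Y' : κ → Type*} [∀ k, Fintype (X' k)] [∀ k, Fintype (Y' k)]
    (U : (k : κ) → Matrix (X' k) X ℂ) (B : (k : κ) → Matrix (Y' k) Y ℂ)
    (hU : ∀ k, (U k)ᴴ * U k = 1) (hB : ∑ k, (B k)ᴴ * B k = 1) (M : Matrix X Y ℂ) :
    ∑ k, matrixConcurrence (U k * M * (B k)ᵀ) ≤ matrixConcurrence M := by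
  simp only [Matrix.mul_assoc, matrixConcurrence_isometry_mul _ (hU _)]
  -- Completeness of the measurement says that the reduced operators on the unmeasured side sum to
  -- the original one.
  refine sum_matrixConcurrence_le _ _ ?_
  calc ∑ k, M * (B k)ᵀ * (M * (B k)ᵀ)ᴴ = ∑ k, M * ((B k)ᴴ * B k)ᵀ * Mᴴ := by
        refine Finset.sum_congr rfl fun k _ => ?_
        rw [Matrix.conjTranspose_mul, Matrix.transpose_mul]
        simp only [Matrix.mul_assoc]
        rfl
    _ = M * (∑ k, (B k)ᴴ * B k)ᵀ * Mᴴ := by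
        rw [Matrix.transpose_sum, Matrix.mul_sum, Matrix.sum_mul]
    _ = M * Mᴴ := by rw [hB]; simp

end Bipartite

/-! ### Products of local operators -/

section ProductOperators

variable {ι : Type*} [Fintype ι]

/-- The product operator `⨂ j, A j` of an arbitrary finite family of matrices. -/
def piKronecker {a b : ι → Type*} (A : (j : ι) → Matrix (a j) (b j) ℂ) :
    Matrix ((j : ι) → a j) ((j : ι) → b j) ℂ :=
  Matrix.of fun x y => ∏ j, A j (x j) (y j)

theorem conjTranspose_piKronecker_mul_self [DecidableEq ι] {a b : ι → Type*}
    [∀ j, Fintype (a j)] (A : (j : ι) → Matrix (a j) (b j) ℂ) :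
    (piKronecker A)ᴴ * piKronecker A = piKronecker fun j => (A j)ᴴ * A j := by
  ext x y
  simp only [piKronecker, Matrix.mul_apply, Matrix.conjTranspose_apply, Matrix.of_apply,
    star_prod, ← Finset.prod_mul_distrib]
  rw [Finset.prod_univ_sum, Fintype.piFinset_univ]

theorem piKronecker_one [DecidableEq ι] {b : ι → Type*} [∀ j, DecidableEq (b j)] :
    piKronecker (fun j => (1 : Matrix (b j) (b j) ℂ)) = 1 := by
  ext x y
  simp only [piKronecker, Matrix.of_apply, Matrix.one_apply]
  by_cases h : x = y
  · simp [h]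
  · obtain ⟨j, hj⟩ := Function.ne_iff.1 h
    rw [if_neg h]
    exact Finset.prod_eq_zero (Finset.mem_univ j) (if_neg hj)

/-- Only factor `i` depends on `k`, and the product is linear in that factor. -/
theorem sum_piKronecker_of_eq_one [DecidableEq ι] {κ : Type*} [Fintype κ] {b : ι → Type*}
    [∀ j, DecidableEq (b j)] (i : ι) (E : κ → (j : ι) → Matrix (b j) (b j) ℂ)
    (hi : ∑ k, E k i = 1) (hne : ∀ k j, j ≠ i → E k j = 1) :
    ∑ k, piKronecker (E k) = 1 := by
  rw [← piKronecker_one]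
  ext x y
  simp only [piKronecker, Matrix.of_apply, Matrix.sum_apply]
  simp only [Fintype.prod_eq_mul_prod_compl i]
  rw [← hi, Matrix.sum_apply, Finset.sum_mul]
  refine Finset.sum_congr rfl fun k _ => ?_
  congr 1
  refine Finset.prod_congr rfl fun j hj => ?_
  rw [hne k j (by simpa using hj)]

end ProductOperators

/-! ### Coefficient matrices across a bipartition -/

variable {d : Fin 4 → ℕ}

/-- The coefficient matrix of `ψ` with respect to the bipartition `S | Sᶜ`. -/
def coeffMatrix (S : Finset (Fin 4)) (ψ : Hilb d) : Matrix (SubIdx d S) (CoIdx d S) ℂ :=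
  Matrix.of fun x y => ψ (glue S x y)

theorem glue_mem (S : Finset (Fin 4)) (x : SubIdx d S) (y : CoIdx d S) (j : {j // j ∈ S}) :
    glue S x y j = x j := by
  simp [glue, Equiv.piEquivPiSubtypeProd]

theorem glue_notMem (S : Finset (Fin 4)) (x : SubIdx d S) (y : CoIdx d S) (j : {j // j ∉ S}) :
    glue S x y j = y j := by
  simp [glue, Equiv.piEquivPiSubtypeProd, j.2]

theorem glue_restrict (S : Finset (Fin 4)) (z : Idx d) :
    glue S (fun j => z j) (fun j => z j) = z :=
  (Equiv.piEquivPiSubtypeProd (fun i : Fin 4 => i ∈ S) (fun i => Fin (d i))).symm_apply_apply z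

theorem sum_glue {M : Type*} [AddCommMonoid M] (S : Finset (Fin 4)) (f : Idx d → M) :
    ∑ z, f z = ∑ x : SubIdx d S, ∑ y : CoIdx d S, f (glue S x y) := by
  rw [← Fintype.sum_prod_type', ← (Equiv.piEquivPiSubtypeProd (fun i : Fin 4 => i ∈ S)
    (fun i => Fin (d i))).symm.sum_comp]
  rfl

theorem partialTrace_density (S : Finset (Fin 4)) (ψ : Hilb d) :
    partialTrace S (density ψ) = coeffMatrix S ψ * (coeffMatrix S ψ)ᴴ := by
  ext x x'
  simp [partialTrace, density, coeffMatrix, Matrix.mul_apply]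

theorem trace_coeffMatrix (S : Finset (Fin 4)) (ψ : Hilb d) :
    (coeffMatrix S ψ * (coeffMatrix S ψ)ᴴ).trace.re = ‖ψ‖ ^ 2 := by
  rw [trace_mul_conjTranspose_re, EuclideanSpace.norm_sq_eq, sum_glue S]
  rfl

theorem concurrence_eq_matrixConcurrence (S : Finset (Fin 4)) {ψ : Hilb d} (hψ : ‖ψ‖ = 1) :
    concurrence S ψ = matrixConcurrence (coeffMatrix S ψ) := by
  rw [concurrence, matrixConcurrence, partialTrace_density, trace_coeffMatrix, hψ, pow_two]
  norm_num

theorem coeffMatrix_smul (S : Finset (Fin 4)) (c : ℂ) (ψ : Hilb d) :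
    coeffMatrix S (c • ψ) = c • coeffMatrix S ψ := by
  ext x y
  simp [coeffMatrix]

theorem coeffMatrix_tensorOp {e : Fin 4 → ℕ} (S : Finset (Fin 4))
    (A : (j : Fin 4) → Matrix (Fin (e j)) (Fin (d j)) ℂ) (ψ : Hilb d) :
    coeffMatrix S (WithLp.toLp 2 (tensorOp A *ᵥ ψ)) =
      piKronecker (fun j : {j // j ∈ S} => A j) * coeffMatrix S ψ *
        (piKronecker (fun j : {j // j ∉ S} => A j))ᵀ := by
  have hprod : ∀ (x x') (y y'), tensorOp A (glue S x y) (glue S x' y') =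
      (∏ j : {j // j ∈ S}, A j (x j) (x' j)) * ∏ j : {j // j ∉ S}, A j (y j) (y' j) := by
    intro x x' y y'
    rw [tensorOp, Matrix.of_apply, ← Fintype.prod_subtype_mul_prod_subtype (fun j => j ∈ S)]
    simp only [glue_mem, glue_notMem]
    congr!
  ext x y
  simp only [coeffMatrix, Matrix.of_apply, Matrix.mulVec, dotProduct, sum_glue S, hprod,
    Matrix.mul_apply, Matrix.transpose_apply, piKronecker, Finset.sum_mul]
  rw [Finset.sum_comm]
  refine Finset.sum_congr rfl fun y' _ => Finset.sum_congr rfl fun x' _ => ?_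
  ring

theorem density_tensorOp {e : Fin 4 → ℕ}
    (A : (j : Fin 4) → Matrix (Fin (e j)) (Fin (d j)) ℂ) (ψ : Hilb d) :
    density (WithLp.toLp 2 (tensorOp A *ᵥ ψ)) = tensorOp A * density ψ * (tensorOp A)ᴴ := by
  have h : ∀ {d : Fin 4 → ℕ} (ψ : Hilb d), density ψ = Matrix.vecMulVec ψ (star ⇑ψ) :=
    fun _ => rfl
  rw [h, h, Matrix.mul_vecMulVec, Matrix.vecMulVec_mul, Matrix.star_mulVec]

/-! ### Monotonicity under LOCC -/

/-- On average, a round of an LOCC protocol does not increase the concurrence. -/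
theorem sum_matrixConcurrence_round_le {κ : Type*} [Fintype κ] (i : Fin 4)
    {e : κ → Fin 4 → ℕ} (A : (k : κ) → (j : Fin 4) → Matrix (Fin (e k j)) (Fin (d j)) ℂ)
    (measurement : ∑ k, (A k i)ᴴ * A k i = 1)
    (isometry : ∀ k j, j ≠ i → (A k j)ᴴ * A k j = 1) (S : Finset (Fin 4)) (ψ : Hilb d) :
    ∑ k, matrixConcurrence (coeffMatrix S (WithLp.toLp 2 (tensorOp (A k) *ᵥ ψ))) ≤
      matrixConcurrence (coeffMatrix S ψ) := by
  simp only [coeffMatrix_tensorOp]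
  by_cases hi : i ∈ S
  -- The measuring party lies on the row side here; transposing moves it to the column side.
  · simp only [← matrixConcurrence_transpose (coeffMatrix S ψ),
      ← matrixConcurrence_transpose (_ * _ * _), Matrix.transpose_mul, Matrix.transpose_transpose]
    simp only [← Matrix.mul_assoc]
    apply sum_matrixConcurrence_isometry_measurement_le
    · intro k
      rw [conjTranspose_piKronecker_mul_self, ← piKronecker_one]
      congr 1
      ext1 j
      exact isometry k j fun h => j.2 (h ▸ hi)
    · simp only [conjTranspose_piKronecker_mul_self]
      exact sum_piKronecker_of_eq_one ⟨i, hi⟩ _ measurement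
        fun k j hj => isometry k j fun h => hj (Subtype.ext h)
  · apply sum_matrixConcurrence_isometry_measurement_le
    · intro k
      rw [conjTranspose_piKronecker_mul_self, ← piKronecker_one]
      congr 1
      ext1 j
      exact isometry k j fun h => hi (h ▸ j.2)
    · simp only [conjTranspose_piKronecker_mul_self]
      exact sum_piKronecker_of_eq_one ⟨i, hi⟩ _ measurement
        fun k j hj => isometry k j fun h => hj (Subtype.ext h)

/-- An LOCC map sends a pure state to a mixture of (subnormalised) pure states whose total
concurrence across each bipartition does not exceed that of the initial state. -/
theorem IsLOCC.exists_ensemble {d' : Fin 4 → ℕ} {Λ : Op d → Op d'} (h : IsLOCC d' d Λ) :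
    ∀ ψ : Hilb d, ∃ (κ : Type) (_ : Fintype κ) (χ : κ → Hilb d'),
      Λ (density ψ) = ∑ k, density (χ k) ∧
      ∀ S, ∑ k, matrixConcurrence (coeffMatrix S (χ k)) ≤
        matrixConcurrence (coeffMatrix S ψ) := by
  induction h with
  | done => exact fun ψ => ⟨Unit, inferInstance, fun _ => ψ, by simp, fun S => by simp⟩
  | round d i m e A measurement isometry Λ rest ih =>
    intro ψ
    choose κ hκ χ hχ hle using fun k => ih k (WithLp.toLp 2 (tensorOp (A k) *ᵥ ψ))
    refine ⟨Σ k, κ k, inferInstance, fun p => χ p.1 p.2, ?_, fun S => ?_⟩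
    · simp only [← density_tensorOp, hχ, Fintype.sum_sigma]
    · rw [Fintype.sum_sigma]
      exact (Finset.sum_le_sum fun k _ => hle k S).trans
        (sum_matrixConcurrence_round_le i A measurement isometry S ψ)

theorem inner_density_mulVec (v χ : Hilb d) :
    star ⇑v ⬝ᵥ density χ *ᵥ ⇑v = (‖inner ℂ v χ‖ ^ 2 : ℝ) := by
  have h : density χ = Matrix.vecMulVec χ (star ⇑χ) := rfl
  have h1 : star ⇑v ⬝ᵥ ⇑χ = inner ℂ v χ := by
    rw [EuclideanSpace.inner_eq_star_dotProduct, dotProduct_comm]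
  have h2 : star ⇑χ ⬝ᵥ ⇑v = starRingEnd ℂ (inner ℂ v χ) := by
    rw [inner_conj_symm, EuclideanSpace.inner_eq_star_dotProduct, dotProduct_comm]
  rw [h, Matrix.vecMulVec_mulVec, h2]
  rw [dotProduct_smul, h1, op_smul_eq_mul, Complex.mul_conj, Complex.normSq_eq_norm_sq]

/-- Pure states are extreme: the terms of a decomposition of `|φ⟩⟨φ|` are multiples of `φ`. -/
theorem exists_smul_of_sum_density_eq {κ : Type*} [Fintype κ] {χ : κ → Hilb d} {φ : Hilb d}
    (hφ : ‖φ‖ = 1) (h : ∑ k, density (χ k) = density φ) (k : κ) : ∃ c : ℂ, χ k = c • φ := by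
  refine ⟨inner ℂ φ (χ k), ?_⟩
  -- The component of `χ k` orthogonal to `φ`. The expectation of the decomposition in `v` is zero,
  -- so `v` is orthogonal to every `χ l`; for `l = k` this forces `v = 0`.
  set v : Hilb d := χ k - (inner ℂ φ (χ k) : ℂ) • φ with hv
  have hvφ : inner ℂ v φ = 0 := by
    rw [hv, inner_sub_left, inner_smul_left, inner_self_eq_norm_sq_to_K, hφ]
    simp
  have hsum : ∑ l, ‖inner ℂ v (χ l)‖ ^ 2 = 0 := by
    have h1 := congrArg (fun ρ : Op d => star ⇑v ⬝ᵥ ρ *ᵥ ⇑v) h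
    simp only [Matrix.sum_mulVec, dotProduct_sum, inner_density_mulVec, hvφ] at h1
    rw [← Complex.ofReal_sum] at h1
    have := Complex.ofReal_injective h1
    simpa using this
  have hk : inner ℂ v (χ k) = 0 := by
    rw [Finset.sum_eq_zero_iff_of_nonneg fun _ _ => by positivity] at hsum
    simpa using hsum k (Finset.mem_univ k)
  have hχ : χ k = v + (inner ℂ φ (χ k) : ℂ) • φ := by rw [hv]; abel
  rw [hχ, inner_add_right, inner_smul_right, hvφ, mul_zero, add_zero, inner_self_eq_zero] at hk
  exact sub_eq_zero.1 hk

theorem trace_density (ψ : Hilb d) : (density ψ).trace.re = ‖ψ‖ ^ 2 := by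
  simp only [Matrix.trace, Matrix.diag, density, Matrix.of_apply, RCLike.star_def,
    Complex.mul_conj, Complex.re_sum, Complex.ofReal_re, Complex.normSq_eq_norm_sq]
  rw [EuclideanSpace.norm_sq_eq]

/-- The branches are `c k • φ` with `∑ k, ‖c k‖ ^ 2 = 1`. As the concurrence is homogeneous of
degree two, their total is that of `φ`. -/
theorem concurrence_le_of_isLOCC {d' : Fin 4 → ℕ} {Λ : Op d → Op d'} (hΛ : IsLOCC d' d Λ)
    {ψ : Hilb d} {φ : Hilb d'} (hψ : ‖ψ‖ = 1) (hφ : ‖φ‖ = 1)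
    (h : Λ (density ψ) = density φ) (S : Finset (Fin 4)) :
    concurrence S φ ≤ concurrence S ψ := by
  obtain ⟨κ, _, χ, hχ, hle⟩ := hΛ.exists_ensemble ψ
  rw [h] at hχ
  choose c hc using exists_smul_of_sum_density_eq hφ hχ.symm
  have htr : ∑ k, ‖c k‖ ^ 2 = 1 := by
    have := congrArg (fun ρ : Op d' => ρ.trace.re) hχ
    simpa only [Matrix.trace_sum, Complex.re_sum, trace_density, hc, norm_smul, hφ, mul_one,
      one_pow, eq_comm] using this
  have := hle S
  simp only [hc, coeffMatrix_smul, matrixConcurrence_smul, ← Finset.sum_mul, htr, one_mul] at this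
  rwa [concurrence_eq_matrixConcurrence S hψ, concurrence_eq_matrixConcurrence S hφ]

/-! ### Product vectors and vanishing concurrence -/

theorem isProductAcross_iff_matrixConcurrence_eq_zero (S : Finset (Fin 4)) (ψ : Hilb d) :
    IsProductAcross S ψ ↔ matrixConcurrence (coeffMatrix S ψ) = 0 := by
  rw [matrixConcurrence_eq_zero_iff]
  constructor
  · rintro ⟨α, β, h⟩ x x' y y'
    simp only [coeffMatrix, Matrix.of_apply, h]
    ring
  · intro h
    by_cases h0 : ∃ x y, coeffMatrix S ψ x y ≠ 0
    · obtain ⟨x₀, y₀, h0⟩ := h0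
      -- Rank one factorisation: the column through a nonzero pivot, divided by the pivot, times its
      -- row.
      refine ⟨fun x => coeffMatrix S ψ x y₀ / coeffMatrix S ψ x₀ y₀,
        fun y => coeffMatrix S ψ x₀ y, fun x y => ?_⟩
      rw [div_mul_eq_mul_div, eq_div_iff h0, h x x₀ y₀ y]
      rfl
    · push Not at h0
      exact ⟨0, 0, fun x y => (h0 x y).trans (zero_mul 0).symm⟩

theorem IsProductAcross.compl {S : Finset (Fin 4)} {ψ : Hilb d} (h : IsProductAcross S ψ) :
    IsProductAcross Sᶜ ψ := by
  obtain ⟨α, β, h⟩ := h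
  refine ⟨fun x => β fun j => x ⟨j, Finset.mem_compl.2 j.2⟩,
    fun y => α fun j => y ⟨j, fun hj => Finset.mem_compl.1 hj j.2⟩, fun x y => ?_⟩
  rw [← glue_restrict S (glue Sᶜ x y), h, mul_comm]
  congr 2
  · ext1 j
    exact glue_mem Sᶜ x y ⟨j, Finset.mem_compl.2 j.2⟩
  · ext1 j
    exact glue_notMem Sᶜ x y ⟨j, fun hj => Finset.mem_compl.1 hj j.2⟩

theorem IsProductAcross.of_smul {S : Finset (Fin 4)} {ψ φ : Hilb d} {c : ℂ} (h : ψ = c • φ)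
    (hφ : IsProductAcross S φ) : IsProductAcross S ψ := by
  rw [isProductAcross_iff_matrixConcurrence_eq_zero] at hφ ⊢
  rw [h, coeffMatrix_smul, matrixConcurrence_smul, hφ, mul_zero]

theorem isBiproduct_iff (ψ : Hilb d) :
    IsBiproduct ψ ↔ (∃ i, IsProductAcross {i} ψ) ∨ ∃ j : Fin 3, IsProductAcross {0, j.succ} ψ := by
  constructor
  · rintro ⟨S, hS, hS', h⟩
    -- One of `S`, `Sᶜ` is a singleton, or both are pairs and one of them contains party `0`.
    have key : ∀ S : Finset (Fin 4), S.Nonempty → Sᶜ.Nonempty →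
        (∃ i, S = {i} ∨ Sᶜ = {i}) ∨ ∃ j : Fin 3, S = {0, j.succ} ∨ Sᶜ = {0, j.succ} := by
      decide
    rcases key S hS hS' with ⟨i, hi | hi⟩ | ⟨j, hj | hj⟩
    · exact Or.inl ⟨i, hi ▸ h⟩
    · exact Or.inl ⟨i, hi ▸ h.compl⟩
    · exact Or.inr ⟨j, hj ▸ h⟩
    · exact Or.inr ⟨j, hj ▸ h.compl⟩
  · rintro (⟨i, h⟩ | ⟨j, h⟩)
    · refine ⟨{i}, Finset.singleton_nonempty i, ?_, h⟩
      clear h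
      revert i
      decide
    · refine ⟨{0, j.succ}, Finset.insert_nonempty _ _, ?_, h⟩
      clear h
      revert j
      decide

/-! ### The volume as a function of the concurrences -/

theorem pyramidVolume_eq_zero_iff {c : Fin 4 → ℝ} {e : Fin 3 → ℝ} (hc : ∀ i, 0 ≤ c i)
    (he : ∀ j, 0 ≤ e j) : pyramidVolume c e = 0 ↔ (∃ i, c i = 0) ∨ ∃ j, e j = 0 := by
  have hc' : 0 ≤ ∏ i, c i := Finset.prod_nonneg fun i _ => hc i
  have he' : 0 ≤ ∏ j, e j := Finset.prod_nonneg fun j _ => he j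
  simp only [pyramidVolume, edgeLength, height, mul_eq_zero, pow_eq_zero_iff two_ne_zero,
    Real.rpow_eq_zero hc' (by norm_num : (1 : ℝ) / 4 ≠ 0),
    Real.rpow_eq_zero he' (by norm_num : (1 : ℝ) / 3 ≠ 0), Finset.prod_eq_zero_iff,
    Finset.mem_univ, true_and]
  norm_num

theorem pyramidVolume_nonneg {c : Fin 4 → ℝ} {e : Fin 3 → ℝ} (he : ∀ j, 0 ≤ e j) :
    0 ≤ pyramidVolume c e := by
  have he' : 0 ≤ ∏ j, e j := Finset.prod_nonneg fun j _ => he j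
  unfold pyramidVolume height
  positivity

theorem pyramidVolume_mono {c c' : Fin 4 → ℝ} {e e' : Fin 3 → ℝ} (hc : ∀ i, 0 ≤ c i)
    (he : ∀ j, 0 ≤ e j) (hcc' : ∀ i, c i ≤ c' i) (hee' : ∀ j, e j ≤ e' j) :
    pyramidVolume c e ≤ pyramidVolume c' e' := by
  have hc' : 0 ≤ ∏ i, c i := Finset.prod_nonneg fun i _ => hc i
  have he' : 0 ≤ ∏ j, e j := Finset.prod_nonneg fun j _ => he j
  have h1 : ∏ i, c i ≤ ∏ i, c' i := Finset.prod_le_prod (fun i _ => hc i) fun i _ => hcc' i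
  have h2 : ∏ j, e j ≤ ∏ j, e' j := Finset.prod_le_prod (fun j _ => he j) fun j _ => hee' j
  unfold pyramidVolume edgeLength height
  gcongr

theorem concurrence_nonneg (S : Finset (Fin 4)) (ψ : Hilb d) : 0 ≤ concurrence S ψ :=
  Real.sqrt_nonneg _

theorem V_nonneg (ψ : Hilb d) : 0 ≤ V ψ :=
  pyramidVolume_nonneg fun _ => concurrence_nonneg _ ψ

theorem V_eq_zero_iff {ψ : Hilb d} (hψ : ‖ψ‖ = 1) : V ψ = 0 ↔ IsBiproduct ψ := by
  rw [V, pyramidVolume_eq_zero_iff (c := oneThree ψ) (e := twoTwo ψ)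
    (fun _ => concurrence_nonneg _ ψ) (fun _ => concurrence_nonneg _ ψ), isBiproduct_iff]
  simp only [oneThree, twoTwo, concurrence_eq_matrixConcurrence _ hψ,
    isProductAcross_iff_matrixConcurrence_eq_zero]

/-- Absorbs convex weights into the vectors, so that `exists_smul_of_sum_density_eq` applies to
convex combinations. -/
theorem density_real_smul {w : ℝ} (hw : 0 ≤ w) (ψ : Hilb d) :
    density ((Real.sqrt w : ℂ) • ψ) = w • density ψ := by
  ext x y
  have hs : (Real.sqrt w : ℂ) * (Real.sqrt w : ℂ) = w := by
    rw [← Complex.ofReal_mul, Real.mul_self_sqrt hw]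
  simp only [density, Matrix.of_apply, Matrix.smul_apply, PiLp.smul_apply, smul_eq_mul,
    star_mul', RCLike.star_def, Complex.conj_ofReal, Complex.real_smul, ← hs]
  ring

theorem isBiseparable_density_iff {ψ : Hilb d} (hψ : ‖ψ‖ = 1) :
    IsBiseparable (density ψ) ↔ IsBiproduct ψ := by
  refine ⟨fun h => ?_, fun h => subset_convexHull ℝ _ ⟨ψ, hψ, h, rfl⟩⟩
  obtain ⟨κ, _, w, σ, hw, hw1, hσ, hsum⟩ := mem_convexHull_iff_exists_fintype.1 h
  choose φ hφ hφb hφσ using hσ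
  have hsum' : ∑ k, density ((Real.sqrt (w k) : ℂ) • φ k) = density ψ := by
    simp only [density_real_smul (hw _), ← hφσ, hsum]
  -- A term of positive weight is a nonzero multiple of `ψ`, so `ψ` inherits its product structure.
  obtain ⟨k, -, hk⟩ : ∃ k ∈ Finset.univ, w k ≠ 0 :=
    Finset.exists_ne_zero_of_sum_ne_zero (by rw [hw1]; exact one_ne_zero)
  obtain ⟨c, hc⟩ := exists_smul_of_sum_density_eq hψ hsum' k
  have hs : (Real.sqrt (w k) : ℂ) ≠ 0 := by
    exact_mod_cast (Real.sqrt_ne_zero (hw k)).2 hk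
  have hc0 : c ≠ 0 := by
    rintro rfl
    rw [zero_smul] at hc
    have h0 : φ k = 0 := (smul_eq_zero.1 hc).resolve_left hs
    simpa [h0] using hφ k
  obtain ⟨S, hS, hS', hp⟩ := hφb k
  refine ⟨S, hS, hS', hp.of_smul (c := c⁻¹ * Real.sqrt (w k)) ?_⟩
  rw [mul_smul, hc, inv_smul_smul₀ hc0]

end FourPartite

open FourPartite
theorem theorem1 :
    IsGMEMeasure (fun (d : Fin 4 → ℕ) (ψ : Hilb d) => V ψ) ∧
    (∀ (d : Fin 4 → ℕ) (ψ : Hilb d), ‖ψ‖ = 1 →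
      (0 < V ψ ↔ IsGME (density ψ)) ∧ (V ψ = 0 ↔ IsBiproduct ψ)) ∧
    (∀ (c c' : Fin 4 → ℝ) (e e' : Fin 3 → ℝ),
      (∀ i, 0 ≤ c i) → (∀ j, 0 ≤ e j) → (∀ i, c i ≤ c' i) → (∀ j, e j ≤ e' j) →
      pyramidVolume c e ≤ pyramidVolume c' e') := by
  have hpos : ∀ (d : Fin 4 → ℕ) (ψ : Hilb d), ‖ψ‖ = 1 → (0 < V ψ ↔ IsGME (density ψ)) := by
    intro d ψ hψ
    rw [IsGME, isBiseparable_density_iff hψ, ← V_eq_zero_iff hψ, (V_nonneg ψ).lt_iff_ne', ne_eq]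
  refine ⟨⟨fun d ψ hψ h => ?_, fun d ψ hψ h => (hpos d ψ hψ).2 h, ?_⟩,
    fun d ψ hψ => ⟨hpos d ψ hψ, V_eq_zero_iff hψ⟩, fun c c' e e' => pyramidVolume_mono⟩
  · exact (V_eq_zero_iff hψ).2 ((isBiseparable_density_iff hψ).1 h)
  · intro d d' ψ φ Λ hψ hφ hΛ h
    exact pyramidVolume_mono (fun _ => concurrence_nonneg _ φ) (fun _ => concurrence_nonneg _ φ)
      (fun _ => concurrence_le_of_isLOCC hΛ hψ hφ h _)
      (fun _ => concurrence_le_of_isLOCC hΛ hψ hφ h _)
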